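/- **Setting.** Consider a slotted-time $K\times N$ input-queued multicast switch and a traffic pattern, i.e. a finite set of flows $(i,J)$ with $i$ an input and $J$ a nonempty set of outputs (the fanout). The subflows are the triples $(i,J,j)$ with $(i,J)$ a flow and $j\in J$. The enhanced conflict graph $G$ has the subflows as vertices; distinct $(i,J,j)$ and $(i',J',j')$ are adjacent iff $j=j'$, or $i=i'$ and $J\neq J'$. $\mathrm{STAB}(G)$ is the convex hull of the incidence vectors of the stable sets of $G$. For a rate vector $r\ge 0$ indexed by flows put $e(r)_{iJj}=r_{iJ}$. The coding rate region is $\mathbf R=\{r\ge 0: e(r)\in \mathrm{STAB}(G)\}$. Let $\mathbb F$ be a finite field with $|\mathbb F|>|J|$ for every flow $(i,J)$. In slot $t=0,1,2,\dots$, $a_{iJ}(t)\in\mathbb N$ packets of flow $(i,J)$ arrive. At the start of slot $t$ the knowledge space of input $i$ for flow $(i,J)$ is the space of coefficient vectors over $\mathbb F$ of all linear combinations of the packets of that flow that arrived in slots $0,\dots,t-1$; the knowledge space of output $j\in J$ for that flow is the span of the coefficient vectors of the combinations of that flow that it received in slots $0,\dots,t-1$ (so it is $0$ at $t=0$). The virtual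 queue size $q_{iJj}(t)$ is the dimension of the former minus the dimension of the latter. **MWSS algorithm.** Fix a rule assigning to every vector of queue sizes a stable set of $G$ that has maximum total weight when the queue sizes are used as vertex weights (ties are broken in an arbitrary fixed way). In slot $t$: (1) take the stable set that the rule assigns to $q(t)$ and drop from it the subflows with $q_{iJj}(t)=0$; (2) for every flow with chosen subflows take a linear combination of the packets of the flow received before slot $t$ that is innovative for all chosen outputs of the flow, i.e. whose coefficient vector lies outside the knowledge spaces of these outputs; (3) transfer it to these outputs. **Theorem.** Suppose that the random variables $a_{iJ}(t)$ (over all flows and all $t$) are independent, that for each flow they are identically distributed in $t$ with mean $r_{iJ}$ and finite second moment, and that $r$ lies in the interior of $\mathbf R$ relative to the nonnegative orthant. Then 1. step (2) can always be carried out: on every sample path, if it was carried out in all slots before $t$, then a combination as required exists in slot $t$ for every flow; 2. whichever innovative combinations are used, the virtual queues are stable in the mean: for every subflow $(i,J,j)$, $E[q_{iJj}(t)]<\infty$ for all $t$, and $\lim_{t\to\infty}E[q_{iJj}(t)]$ exists and is finite. -/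

import Mathlib

open MeasureTheory ProbabilityTheory Filter Topology
open scoped NNReal

noncomputable section

namespace MulticastSwitch

/-- A traffic pattern of a `K × N` switch: a finite set of flows `(i, J)`, where `i` is an input and
the fanout set `J` is a nonempty set of outputs. -/
structure TrafficPattern (K N : ℕ) where
  flows : Finset (Fin K × Finset (Fin N))
  fanout_nonempty : ∀ f ∈ flows, f.2.Nonempty

namespace TrafficPattern

variable {K N : ℕ}

/-- The flows `(i, J)` of the pattern. -/
abbrev Flow (P : TrafficPattern K N) : Type := {f : Fin K × Finset (Fin N) // f ∈ P.flows}

/-- The subflows `(i, J, j)` of the pattern: a flow `(i, J)` together with an output `j ∈ J`. -/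
abbrev Subflow (P : TrafficPattern K N) : Type := {s : P.Flow × Fin N // s.2 ∈ s.1.1.2}

variable {P : TrafficPattern K N}

/-- The flow `(i, J)` of the subflow `(i, J, j)`. -/
def Subflow.flow (s : P.Subflow) : P.Flow := s.1.1

/-- The input `i` of the subflow `(i, J, j)`. -/
def Subflow.input (s : P.Subflow) : Fin K := s.1.1.1.1

/-- The fanout set `J` of the subflow `(i, J, j)`. -/
def Subflow.fanout (s : P.Subflow) : Finset (Fin N) := s.1.1.1.2

/-- The output `j` of the subflow `(i, J, j)`. -/
def Subflow.output (s : P.Subflow) : Fin N := s.1.2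

/-- The enhanced conflict graph: distinct subflows `(i, J, j)`, `(i', J', j')` are adjacent iff
`j = j'`, or `i = i'` and `J ≠ J'`. -/
def enhancedConflictGraph (P : TrafficPattern K N) : SimpleGraph P.Subflow where
  Adj u v := u ≠ v ∧ (u.output = v.output ∨ (u.input = v.input ∧ u.fanout ≠ v.fanout))
  symm := ⟨fun _ _ h => ⟨h.1.symm, h.2.imp Eq.symm (fun g => ⟨g.1.symm, g.2.symm⟩)⟩⟩
  loopless := ⟨fun _ h => h.1 rfl⟩

end TrafficPattern

/-- The stable set polytope `STAB(G)`: the convex hull of the incidence vectors of the stable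
(that is, independent) sets of `G`. -/
def stableSetPolytope {V : Type*} (G : SimpleGraph V) : Set (V → ℝ) :=
  convexHull ℝ {x | ∃ S : Set V, G.IsIndepSet S ∧ x = S.indicator 1}

/-- `S` is a stable set of `G` of maximum total weight for the vertex weights `w`. -/
def IsMaxWeightStableSet {V : Type*} (G : SimpleGraph V) (w : V → ℕ) (S : Finset V) : Prop :=
  G.IsIndepSet (S : Set V) ∧
    ∀ T : Finset V, G.IsIndepSet (T : Set V) → ∑ v ∈ T, w v ≤ ∑ v ∈ S, w v

variable {K N : ℕ} {P : TrafficPattern K N}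

/-- The enhanced rate vector `e(r)`: every subflow has the rate of its flow. -/
def enhancedRate (r : P.Flow → ℝ≥0) : P.Subflow → ℝ := fun s => r s.flow

/-- The rate region with linear intra-flow network coding: all nonnegative rate vectors `r` such
that `e(r) ∈ STAB(G)`, where `G` is the enhanced conflict graph. -/
def rateRegion (P : TrafficPattern K N) : Set (P.Flow → ℝ≥0) :=
  {r | enhancedRate r ∈ stableSetPolytope P.enhancedConflictGraph}

section Run

/-! One sample path of the switch. `α t f` is the number of packets of flow `f` that arrive during
slot `t`. The packets of one flow are numbered `0, 1, 2, …` in order of arrival, and a linear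
combination of them is given by its coefficient vector, an element of `ℕ →₀ 𝔽`. -/

variable {𝔽 : Type*} [Field 𝔽]

/-- The knowledge space, at the start of slot `t`, of the input of flow `f` with respect to `f`:
all linear combinations of the packets that arrived in slots `0, …, t - 1`. -/
def inputKnowledge (𝔽 : Type*) [Field 𝔽] (α : ℕ → P.Flow → ℕ) (t : ℕ) (f : P.Flow) :
    Submodule 𝔽 (ℕ →₀ 𝔽) :=
  Submodule.span 𝔽 {v | ∃ k < ∑ τ ∈ Finset.range t, α τ f, v = Finsupp.single k 1}

/-- The size of a virtual queue: the dimension of the knowledge space `U` of the input minus that of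
the knowledge space `W` of the output. (In a run of the algorithm `W ≤ U`, so that the subtraction
is not truncated.) -/
def virtualQueueSize (U W : Submodule 𝔽 (ℕ →₀ 𝔽)) : ℕ :=
  Module.finrank 𝔽 U - Module.finrank 𝔽 W

/-- The subflows served when the queue sizes are `q` and `σ` is the rule that computes a stable set
from the queue sizes: the members of `σ q` with a nonempty virtual queue. -/
def served (σ : (P.Subflow → ℕ) → Finset P.Subflow) (q : P.Subflow → ℕ) : Finset P.Subflow :=
  (σ q).filter fun s => 0 < q s

/-- The knowledge space, at the start of slot `t`, of the output of each subflow with respect to the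
flow of the subflow. Outputs know nothing at time `0`. In slot `t` the linear combination `c t f` is
transferred to the outputs of the served subflows of flow `f`. -/
def outputKnowledge (σ : (P.Subflow → ℕ) → Finset P.Subflow) (α : ℕ → P.Flow → ℕ)
    (c : ℕ → P.Flow → (ℕ →₀ 𝔽)) : ℕ → P.Subflow → Submodule 𝔽 (ℕ →₀ 𝔽)
  | 0 => fun _ => ⊥
  | t + 1 => fun s =>
      if s ∈ served σ (fun u =>
          virtualQueueSize (inputKnowledge 𝔽 α t u.flow) (outputKnowledge σ α c t u))
      then outputKnowledge σ α c t s ⊔ Submodule.span 𝔽 {c t s.flow}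
      else outputKnowledge σ α c t s

/-- The virtual queue sizes at the start of slot `t`. -/
def virtualQueue (σ : (P.Subflow → ℕ) → Finset P.Subflow) (α : ℕ → P.Flow → ℕ)
    (c : ℕ → P.Flow → (ℕ →₀ 𝔽)) (t : ℕ) (s : P.Subflow) : ℕ :=
  virtualQueueSize (inputKnowledge 𝔽 α t s.flow) (outputKnowledge σ α c t s)

/-- `v` is an admissible choice of the linear combination for flow `f` in slot `t`: it combines
packets of `f` received so far, and it is innovative for the outputs of all served subflows of
`f`. -/
def IsInnovativeChoice (σ : (P.Subflow → ℕ) → Finset P.Subflow) (α : ℕ → P.Flow → ℕ)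
    (c : ℕ → P.Flow → (ℕ →₀ 𝔽)) (t : ℕ) (f : P.Flow) (v : ℕ →₀ 𝔽) : Prop :=
  v ∈ inputKnowledge 𝔽 α t f ∧
    ∀ s ∈ served σ (virtualQueue σ α c t), s.flow = f → v ∉ outputKnowledge σ α c t s

end Run

/-- The random queue sizes `q t` are stable in the mean: all expectations are finite and
converge to a finite limit as `t → ∞`. -/
def StableInMean {V Ω : Type*} [MeasurableSpace Ω] (μ : Measure Ω) (q : ℕ → V → Ω → ℕ) : Prop :=
  ∀ s, (∀ t, Integrable (fun ω => (q t s ω : ℝ)) μ) ∧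
    ∃ l : ℝ, Tendsto (fun t => ∫ ω, (q t s ω : ℝ) ∂μ) atTop (𝓝 l)

end MulticastSwitch

end

/-!
Each slot changes the virtual queues in the same way, whichever innovative combinations are used: a
served queue loses one unit of dimension and every queue gains the arrivals of its flow
(`virtualQueue_succ`). Innovative combinations exist because fewer than `|𝔽|` proper subspaces of a
finite-dimensional space over `𝔽` do not cover it (`exists_mem_forall_notMem_of_card_lt`), and a
flow `(i, J)` has at most `|J|` served subflows.

Hence the vector of queue sizes is a Markov chain on a countable set, started at `0` and driven by
independent identically distributed arrival vectors. Two facts about it are used.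

* Drift. A rate vector slightly above `r` is still a convex combination of stable sets, so it is
  beaten by the maximum weight stable set; with second moments of the arrivals this bounds the
  drift of the sum of the squared queue sizes by a constant minus a positive multiple of the total
  queue size (`drift_sum_sq`).
* The state `0` is an atom that is reached from everywhere. As `r f < 1`, a slot has no arrivals
  with positive probability, and without arrivals the queues drain (`nextQueue_zero_drains`). In
  particular the chain stays at `0` with positive probability, so there is no periodicity.

The general statement about Markov chains is `exists_tendsto_pow_apply`. By the drift condition, the
total queue size summed along an excursion from `0` has finite expectation
(`excursionSum_level_ne_top`). Decomposing by the last visit to `0` writes the mean queue size at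
time `n` as the convolution of the probabilities of being at `0` with a summable sequence
(`pow_apply_eq_sum_last_visit`). The former converge by the renewal theorem (`tendsto_renewal`), and
therefore so do the mean queue sizes. Working with operators on `ℝ≥0∞`-valued functions makes all
sums and integrals meaningful before their finiteness is known.
-/

open scoped ENNReal

/-! ### The discrete renewal theorem -/

section Renewal

/-- If every entry of a nonnegative sequence is a weighted sum of the later ones, with positive
weight on the next one, then a zero at the start propagates to the whole sequence. -/
theorem eq_zero_of_eq_tsum_shift {p d : ℕ → ℝ} (hp : ∀ k, 0 ≤ p k) (hp0 : 0 < p 0)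
    (hd : ∀ k, 0 ≤ d k) (hsum : ∀ k, HasSum (fun j => p j * d (k + 1 + j)) (d k))
    (h0 : d 0 = 0) (k : ℕ) : d k = 0 := by
  induction k with
  | zero => exact h0
  | succ k ih =>
    have h := hsum k
    rw [ih] at h
    have h1 := (hasSum_zero_iff_of_nonneg fun j => mul_nonneg (hp j) (hd _)).1 h
    have h2 := congrFun h1 0
    simpa [hp0.ne'] using h2

/-- Evaluated along an ultrafilter, the reversed sequences `u n, u (n - 1), u (n - 2), …` of a
solution of the renewal equation have a limit `w`. It solves the equation on the whole half-line,
and its entries are cluster values of `u`. -/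
theorem exists_limit_of_renewal {r u : ℕ → ℝ} (hr : Antitone r) (hr0 : r 0 = 1)
    (hrs : Summable r) (hu : ∀ n, u n ∈ Set.Icc (0 : ℝ) 1)
    (hru : ∀ n, ∑ k ∈ Finset.range (n + 1), r k * u (n - k) = 1)
    {x : ℝ} (hx : MapClusterPt x atTop u) :
    ∃ w : ℕ → ℝ, w 0 = x ∧ (∀ k, MapClusterPt (w k) atTop u) ∧ (∀ k, w k ∈ Set.Icc (0 : ℝ) 1) ∧
      HasSum (fun k => r k * w k) 1 ∧
      ∀ k, HasSum (fun j => (r j - r (j + 1)) * w (k + 1 + j)) (w k) := by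
  have hrpos : ∀ k, 0 ≤ r k := fun k => hr.le_of_tendsto hrs.tendsto_atTop_zero k
  obtain ⟨U, hU, hUx⟩ := mapClusterPt_iff_ultrafilter.1 hx
  have hlim : ∀ k : ℕ, ∃ y, y ∈ Set.Icc (0 : ℝ) 1 ∧ Tendsto (fun n => u (n - k)) U (𝓝 y) := by
    intro k
    obtain ⟨y, hy, hy'⟩ := (isCompact_Icc (a := (0 : ℝ)) (b := 1)).ultrafilter_le_nhds
      (U.map fun n => u (n - k)) (by
        simp only [Ultrafilter.coe_map, le_principal_iff, mem_map]
        exact Filter.univ_mem' fun n => hu _)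
    exact ⟨y, hy, hy'⟩
  choose w hw hwt using hlim
  have hsub : ∀ k : ℕ, Tendsto (fun n => n - k) (U : Filter ℕ) atTop := fun k =>
    (tendsto_sub_atTop_nat k).mono_left hU
  have hwK : ∀ k, MapClusterPt (w k) atTop u := fun k =>
    MapClusterPt.of_comp (hsub k) ((hwt k).mapClusterPt)
  -- the entries beyond the start of the sequence are set to zero
  have hcut : ∀ m k : ℕ, Tendsto (fun n => if k + m ≤ n then u (n - (k + m)) else 0) U
      (𝓝 (w (k + m))) := by
    intro m k
    refine (hwt (k + m)).congr' ?_
    filter_upwards [hU (eventually_ge_atTop (k + m))] with n hn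
    rw [if_pos hn]
  have hbound : ∀ m n k : ℕ, |if k + m ≤ n then u (n - (k + m)) else 0| ≤ 1 := by
    intro m n k
    split_ifs
    · rw [abs_of_nonneg (hu _).1]; exact (hu _).2
    · simp
  refine ⟨w, ?_, hwK, hw, ?_, ?_⟩
  · exact tendsto_nhds_unique (by simpa using hwt 0) hUx
  · have h1 : Tendsto (fun n => ∑' k, r k * if k + 0 ≤ n then u (n - (k + 0)) else 0) U
        (𝓝 (∑' k, r k * w (k + 0))) := by
      refine tendsto_tsum_of_dominated_convergence hrs (fun k => (hcut 0 k).const_mul _) ?_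
      refine Filter.Eventually.of_forall fun n k => ?_
      rw [norm_mul, Real.norm_of_nonneg (hrpos k)]
      exact mul_le_of_le_one_right (hrpos k) (hbound 0 n k)
    have h2 : ∀ n, ∑' k, r k * (if k + 0 ≤ n then u (n - (k + 0)) else 0) = 1 := by
      intro n
      rw [← hru n, tsum_eq_sum (s := Finset.range (n + 1))]
      · refine Finset.sum_congr rfl fun k hk => ?_
        rw [if_pos (by simpa [Nat.lt_succ_iff] using hk)]; simp
      · intro k hk
        rw [if_neg (by simpa [Nat.lt_succ_iff] using hk)]; simp
    simp only [h2] at h1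
    have h3 : Summable fun k => r k * w k := by
      refine Summable.of_nonneg_of_le (fun k => mul_nonneg (hrpos k) (hw k).1) (fun k => ?_) hrs
      exact mul_le_of_le_one_right (hrpos k) (hw k).2
    have h4 := tendsto_nhds_unique h1 tendsto_const_nhds
    rw [← h4]
    simpa using h3.hasSum
  · intro m
    have hp : ∀ k, 0 ≤ r k - r (k + 1) := fun k => sub_nonneg.2 (hr (Nat.le_succ k))
    have hps : Summable fun k => r k - r (k + 1) :=
      hrs.sub ((summable_nat_add_iff 1).2 hrs)
    have h1 : Tendsto (fun n => ∑' k, (r k - r (k + 1)) *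
        if k + (m + 1) ≤ n then u (n - (k + (m + 1))) else 0) U
        (𝓝 (∑' k, (r k - r (k + 1)) * w (k + (m + 1)))) := by
      refine tendsto_tsum_of_dominated_convergence hps (fun k => (hcut (m + 1) k).const_mul _) ?_
      refine Filter.Eventually.of_forall fun n k => ?_
      rw [norm_mul, Real.norm_of_nonneg (hp k)]
      exact mul_le_of_le_one_right (hp k) (hbound (m + 1) n k)
    -- the renewal equation is the difference of two consecutive instances of `hru`
    have hren : ∀ n, u (n + 1) = ∑ k ∈ Finset.range (n + 1), (r k - r (k + 1)) * u (n - k) := by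
      intro n
      have e1 := hru (n + 1)
      have e2 := hru n
      rw [Finset.sum_range_succ'] at e1
      simp only [Nat.add_sub_add_right, Nat.sub_zero, hr0, one_mul] at e1
      simp only [sub_mul, Finset.sum_sub_distrib]
      linarith
    have h2 : ∀ᶠ n in (U : Filter ℕ), ∑' k, (r k - r (k + 1)) *
        (if k + (m + 1) ≤ n then u (n - (k + (m + 1))) else 0) = u (n - m) := by
      filter_upwards [hU (eventually_ge_atTop (m + 1))] with n hn
      obtain ⟨l, rfl⟩ := Nat.exists_eq_add_of_le hn
      rw [show m + 1 + l - m = l + 1 by omega, hren l, tsum_eq_sum (s := Finset.range (l + 1))]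
      · refine Finset.sum_congr rfl fun k hk => ?_
        have : k ≤ l := by simpa [Nat.lt_succ_iff] using hk
        rw [if_pos (by omega)]
        congr 2; omega
      · intro k hk
        have : ¬ k ≤ l := by simpa [Nat.lt_succ_iff] using hk
        rw [if_neg (by omega)]; simp
    have h3 : Summable fun k => (r k - r (k + 1)) * w (m + 1 + k) := by
      refine Summable.of_nonneg_of_le (fun k => mul_nonneg (hp k) (hw _).1) (fun k => ?_) hps
      exact mul_le_of_le_one_right (hp k) (hw _).2
    have h4 := tendsto_nhds_unique (h1.congr' h2) (hwt m)
    rw [← h4]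
    simpa [add_comm] using h3.hasSum

/-- A discrete renewal theorem. Here `r` is the tail of a return time distribution of finite mean
that charges the value `1`, and `u` is the renewal sequence. The largest and the smallest cluster
value of `u` are considered: the average of bounded quantities can only be extremal if each of them
is, so that a reversed limit of `u` which starts at an extremal value is constant, and the constant
is determined by the tail equation. -/
theorem tendsto_renewal {r u : ℕ → ℝ} (hr : Antitone r) (hr0 : r 0 = 1) (hr1 : r 1 < 1)
    (hrs : Summable r) (hu : ∀ n, u n ∈ Set.Icc (0 : ℝ) 1)
    (hru : ∀ n, ∑ k ∈ Finset.range (n + 1), r k * u (n - k) = 1) :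
    Tendsto u atTop (𝓝 (∑' k, r k)⁻¹) := by
  have hrpos : ∀ k, 0 ≤ r k := fun k => hr.le_of_tendsto hrs.tendsto_atTop_zero k
  have hp : ∀ k, 0 ≤ r k - r (k + 1) := fun k => sub_nonneg.2 (hr (Nat.le_succ k))
  have hp0 : 0 < r 0 - r (0 + 1) := by simpa [hr0] using hr1
  have hp1 : HasSum (fun k => r k - r (k + 1)) 1 := by
    have h := hrs.hasSum.sub ((hasSum_nat_add_iff' 1).2 hrs.hasSum)
    simpa [hr0] using h
  have hR : (∑' k, r k) ≠ 0 := by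
    have := hrs.le_tsum 0 (fun j _ => hrpos j)
    rw [hr0] at this
    linarith
  have hcl : IsCompact {x | MapClusterPt x atTop u} := by
    refine (isCompact_Icc (a := (0 : ℝ)) (b := 1)).of_isClosed_subset isClosed_setOfPred_clusterPt ?_
    intro x hx
    exact isClosed_Icc.mem_of_mapClusterPt hx (Filter.Eventually.of_forall hu)
  have hne : {x | MapClusterPt x atTop u}.Nonempty := by
    obtain ⟨x, -, hx⟩ := (isCompact_Icc (a := (0 : ℝ)) (b := 1)).exists_mapClusterPt (f := atTop)
      (u := u) (tendsto_principal.2 (Filter.Eventually.of_forall hu))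
    exact ⟨x, hx⟩
  have key : ∀ x (w : ℕ → ℝ), (∀ k, w k = x) → HasSum (fun k => r k * w k) 1 →
      x = (∑' k, r k)⁻¹ := by
    intro x w hw h
    simp only [hw] at h
    have := h.unique (hrs.hasSum.mul_right x)
    field_simp
    linarith
  obtain ⟨L, hL, hLmax⟩ := hcl.exists_isGreatest hne
  obtain ⟨l, hl, hlmin⟩ := hcl.exists_isLeast hne
  have hL' : L = (∑' k, r k)⁻¹ := by
    obtain ⟨w, hw0, hwK, -, hws, hwr⟩ := exists_limit_of_renewal hr hr0 hrs hu hru hL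
    refine key L w (fun k => ?_) hws
    have := eq_zero_of_eq_tsum_shift (d := fun k => L - w k) hp hp0
      (fun k => sub_nonneg.2 (hLmax (hwK k))) (fun k => by
        simpa [mul_sub] using (hp1.mul_right L).sub (hwr k)) (by simp [hw0]) k
    exact (sub_eq_zero.1 this).symm
  have hl' : l = (∑' k, r k)⁻¹ := by
    obtain ⟨w, hw0, hwK, -, hws, hwr⟩ := exists_limit_of_renewal hr hr0 hrs hu hru hl
    refine key l w (fun k => ?_) hws
    have := eq_zero_of_eq_tsum_shift (d := fun k => w k - l) hp hp0
      (fun k => sub_nonneg.2 (hlmin (hwK k))) (fun k => by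
        simpa [mul_sub] using (hwr k).sub (hp1.mul_right l)) (by simp [hw0]) k
    exact sub_eq_zero.1 this
  refine (isCompact_Icc (a := (0 : ℝ)) (b := 1)).tendsto_nhds_of_unique_mapClusterPt
    (Filter.Eventually.of_forall hu) fun x _ hx => ?_
  exact le_antisymm (hL' ▸ hLmax hx) (hl' ▸ hlmin hx)

/-- Convolution of a convergent bounded sequence with a summable one. -/
theorem tendsto_convolution {u g : ℕ → ℝ} {l : ℝ} (hu : ∀ n, u n ∈ Set.Icc (0 : ℝ) 1)
    (hul : Tendsto u atTop (𝓝 l)) (hg : Summable g) (hg0 : ∀ n, 0 ≤ g n) :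
    Tendsto (fun n => ∑ k ∈ Finset.range (n + 1), g k * u (n - k)) atTop
      (𝓝 (∑' k, g k * l)) := by
  have h1 : Tendsto (fun n => ∑' k, g k * if k ≤ n then u (n - k) else 0) atTop
      (𝓝 (∑' k, g k * l)) := by
    refine tendsto_tsum_of_dominated_convergence hg (fun k => Tendsto.const_mul _ ?_) ?_
    · refine (hul.comp (tendsto_sub_atTop_nat k)).congr' ?_
      filter_upwards [eventually_ge_atTop k] with n hn
      simp [hn]
    · refine Filter.Eventually.of_forall fun n k => ?_
      rw [norm_mul, Real.norm_of_nonneg (hg0 k)]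
      refine mul_le_of_le_one_right (hg0 k) ?_
      split_ifs
      · rw [Real.norm_of_nonneg (hu _).1]; exact (hu _).2
      · simp
  refine h1.congr fun n => ?_
  rw [tsum_eq_sum (s := Finset.range (n + 1))]
  · refine Finset.sum_congr rfl fun k hk => ?_
    rw [if_pos (by simpa [Nat.lt_succ_iff] using hk)]
  · intro k hk
    rw [if_neg (by simpa [Nat.lt_succ_iff] using hk)]; simp

end Renewal

/-! ### Markov operators with an atom -/

section MarkovOperator

variable {S : Type*}

/-- The transition operator `P` of a Markov chain, killed when the chain enters `o`. -/
noncomputable def tabooOperator (P : Module.End ℝ≥0∞ (S → ℝ≥0∞)) (o : S) :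
    Module.End ℝ≥0∞ (S → ℝ≥0∞) where
  toFun f := P (({o}ᶜ : Set S).indicator f)
  map_add' f g := by rw [Set.indicator_add', map_add]
  map_smul' a f := by
    rw [show ({o}ᶜ : Set S).indicator (a • f) = a • ({o}ᶜ : Set S).indicator f from
      Set.indicator_const_smul _ a f, map_smul]
    rfl

/-- Linear maps are monotone here, since `f ≤ g` means that `g = f + d` for some `d`. -/
theorem linearMap_mono (P : Module.End ℝ≥0∞ (S → ℝ≥0∞)) : Monotone P := by
  intro f g hfg
  obtain ⟨d, rfl⟩ := exists_add_of_le hfg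
  rw [map_add]
  exact le_self_add

variable (P : Module.End ℝ≥0∞ (S → ℝ≥0∞)) (o : S)

/-- The unkilled operator is a rank one perturbation of the killed one. -/
theorem apply_eq_tabooOperator_add (f : S → ℝ≥0∞) :
    P f = tabooOperator P o f + f o • P (({o} : Set S).indicator 1) := by
  have h : f = ({o}ᶜ : Set S).indicator f + f o • ({o} : Set S).indicator 1 := by
    funext x
    by_cases hx : x = o
    · subst hx; simp
    · simp [hx]
  conv_lhs => rw [h, map_add, map_smul]
  rfl

theorem tabooOperator_le (f : S → ℝ≥0∞) : tabooOperator P o f ≤ P f := by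
  rw [apply_eq_tabooOperator_add P o f]
  exact le_self_add

/-- Decomposition with respect to the last visit to `o` before time `n`. -/
theorem pow_apply_eq_sum_last_visit (n : ℕ) (f : S → ℝ≥0∞) :
    (P ^ n) f o = ∑ k ∈ Finset.range (n + 1),
      (tabooOperator P o ^ k) f o * (P ^ (n - k)) (({o} : Set S).indicator 1) o := by
  induction n generalizing f with
  | zero => simp
  | succ n ih =>
    rw [pow_succ, Module.End.mul_apply]
    rw [congrArg (P ^ n) (apply_eq_tabooOperator_add P o f)]
    rw [map_add, map_smul, Pi.add_apply, ih, Finset.sum_range_succ' _ (n + 1)]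
    congr 1
    refine Finset.sum_congr rfl fun k _ => ?_
    rw [pow_succ (tabooOperator P o), Module.End.mul_apply, Nat.add_sub_add_right]

/-- The expectation of the sum of `f` along the chain started at `o`, up to its first return
to `o`. -/
noncomputable def excursionSum (f : S → ℝ≥0∞) : ℝ≥0∞ := ∑' n, (tabooOperator P o ^ n) f o

theorem excursionSum_add (f g : S → ℝ≥0∞) :
    excursionSum P o (f + g) = excursionSum P o f + excursionSum P o g := by
  simp only [excursionSum, map_add, Pi.add_apply, ENNReal.tsum_add]

theorem excursionSum_smul (a : ℝ≥0∞) (f : S → ℝ≥0∞) :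
    excursionSum P o (a • f) = a * excursionSum P o f := by
  simp only [excursionSum, map_smul, Pi.smul_apply, smul_eq_mul, ENNReal.tsum_mul_left]

theorem excursionSum_mono {f g : S → ℝ≥0∞} (h : f ≤ g) :
    excursionSum P o f ≤ excursionSum P o g :=
  ENNReal.tsum_le_tsum fun n => linearMap_mono (tabooOperator P o ^ n) h o

theorem excursionSum_tabooOperator_le (f : S → ℝ≥0∞) :
    excursionSum P o (tabooOperator P o f) ≤ excursionSum P o f := by
  simp only [excursionSum, ← Module.End.mul_apply, ← pow_succ]
  exact ENNReal.tsum_comp_le_tsum_of_injective (add_left_injective 1)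
    fun n => (tabooOperator P o ^ n) f o

/-- Foster's comparison argument: under a drift condition for the killed chain the excursion sum
of `f` is bounded by that of `g`. -/
theorem excursionSum_le_of_drift {V f g : S → ℝ≥0∞} (h : tabooOperator P o V + f ≤ V + g) :
    excursionSum P o f ≤ V o + excursionSum P o g := by
  set T := tabooOperator P o with hT
  have key : ∀ n, ∑ k ∈ Finset.range n, (T ^ k) f o + (T ^ n) V o ≤
      V o + ∑ k ∈ Finset.range n, (T ^ k) g o := by
    intro n
    induction n with
    | zero => simp
    | succ n ih =>
      have h1 : (T ^ (n + 1)) V o + (T ^ n) f o ≤ (T ^ n) V o + (T ^ n) g o := by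
        have := linearMap_mono (T ^ n) h o
        simpa only [map_add, Pi.add_apply, ← Module.End.mul_apply, ← pow_succ] using this
      rw [Finset.sum_range_succ, Finset.sum_range_succ]
      calc ∑ k ∈ Finset.range n, (T ^ k) f o + (T ^ n) f o + (T ^ (n + 1)) V o
          = ∑ k ∈ Finset.range n, (T ^ k) f o + ((T ^ (n + 1)) V o + (T ^ n) f o) := by ring
        _ ≤ ∑ k ∈ Finset.range n, (T ^ k) f o + ((T ^ n) V o + (T ^ n) g o) := by gcongr
        _ = (∑ k ∈ Finset.range n, (T ^ k) f o + (T ^ n) V o) + (T ^ n) g o := by ring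
        _ ≤ (V o + ∑ k ∈ Finset.range n, (T ^ k) g o) + (T ^ n) g o := by gcongr
        _ = _ := by ring
  rw [excursionSum, ENNReal.tsum_eq_iSup_nat]
  refine iSup_le fun n => ?_
  calc _ ≤ _ := le_self_add.trans (key n)
    _ ≤ _ := by
      gcongr
      exact ENNReal.sum_le_tsum _

variable {P} {o}

theorem tabooOperator_one_add (hP : P 1 = 1) :
    tabooOperator P o 1 + P (({o} : Set S).indicator 1) = 1 := by
  have := apply_eq_tabooOperator_add P o 1
  rw [hP, Pi.one_apply, one_smul] at this
  exact this.symm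

/-- An excursion ends at most once. -/
theorem excursionSum_hit_le_one (hP : P 1 = 1) :
    excursionSum P o (P (({o} : Set S).indicator 1)) ≤ 1 := by
  have h := excursionSum_le_of_drift P o (V := 1) (g := 0)
    ((tabooOperator_one_add hP).le.trans (add_zero _).ge)
  simpa [excursionSum] using h

/-- If the level `h` drops, or `o` is entered, with probability at least `δ` in each step, then
every sublevel set is visited a bounded expected number of times before the return to `o`. -/
theorem excursionSum_sublevel_ne_top (hP : P 1 = 1) {h : S → ℕ} {δ : ℝ≥0∞} (hδ : δ ≠ 0)
    (hlev : ∀ x, δ ≤ P ({y | y = o ∨ h y < h x}.indicator 1) x) (k : ℕ) :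
    excursionSum P o ({y | h y < k}.indicator 1) ≠ ⊤ := by
  induction k with
  | zero =>
    have : {y | h y < 0}.indicator (1 : S → ℝ≥0∞) = 0 := by
      funext y
      simp
    rw [this]
    simp [excursionSum]
  | succ k ih =>
    have hle : δ • ({y | h y < k + 1}.indicator (1 : S → ℝ≥0∞)) ≤
        tabooOperator P o ({y | h y < k}.indicator 1) + P (({o} : Set S).indicator 1) := by
      intro x
      by_cases hx : h x < k + 1
      · have hx' : h x ≤ k := Nat.lt_succ_iff.1 hx
        simp only [Pi.smul_apply, Set.mem_ofPred_eq, hx, Set.indicator_of_mem, Pi.one_apply,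
          smul_eq_mul, mul_one]
        refine (hlev x).trans ?_
        change _ ≤ (P _ + P _) x
        rw [← map_add]
        refine linearMap_mono P (fun y => ?_) x
        by_cases hy : y = o
        · subst hy; simp
        · by_cases hy' : h y < h x
          · simp [hy, hy', hy'.trans_le hx']
          · simp [hy, hy']
      · rw [Pi.smul_apply, Set.indicator_of_notMem (by exact hx), smul_zero]
        exact zero_le
    have h1 := excursionSum_mono P o hle
    rw [excursionSum_smul, excursionSum_add] at h1
    have h2 : δ * excursionSum P o ({y | h y < k + 1}.indicator 1) ≠ ⊤ := by
      refine ne_top_of_le_ne_top (ENNReal.add_ne_top.2 ⟨?_, ?_⟩) h1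
      · exact ne_top_of_le_ne_top ih (excursionSum_tabooOperator_le P o _)
      · exact ne_top_of_le_ne_top ENNReal.one_ne_top (excursionSum_hit_le_one hP)
    intro h3
    rw [h3, ENNReal.mul_top hδ] at h2
    exact h2 rfl

/-- Under the drift condition, both the length of an excursion from `o` and the sum of the levels
along it have finite expectation. -/
theorem excursionSum_level_ne_top (hP : P 1 = 1) {h : S → ℕ} {δ : ℝ≥0∞} (hδ : δ ≠ 0)
    (hlev : ∀ x, δ ≤ P ({y | y = o ∨ h y < h x}.indicator 1) x)
    {V : S → ℝ≥0∞} (hV : V o ≠ ⊤) {c b : ℝ≥0} (hc : c ≠ 0)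
    (hdrift : ∀ x, P V x + c * h x ≤ V x + b) :
    excursionSum P o (fun x => (h x : ℝ≥0∞) + 1) ≠ ⊤ := by
  have hc0 : 0 < c := pos_iff_ne_zero.2 hc
  -- beyond level `H` half of the drift compensates the constant `b`
  obtain ⟨H, hH⟩ : ∃ H : ℕ, b + c / 2 ≤ c / 2 * H := by
    obtain ⟨H, hH⟩ := exists_nat_ge ((b + c / 2) / (c / 2))
    exact ⟨H, by rw [div_le_iff₀ (by positivity)] at hH; rwa [mul_comm]⟩
  have hnn : ∀ m : ℕ, b + c / 2 * (m + 1) ≤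
      c * m + (b + c / 2 * (H + 1)) * (if m < H then 1 else 0) := by
    intro m
    split_ifs with hm
    · have : (m : ℝ≥0) ≤ H := by exact_mod_cast hm.le
      have h2 : c / 2 * (m + 1) ≤ c / 2 * (H + 1) := by gcongr
      calc b + c / 2 * (m + 1) ≤ b + c / 2 * (H + 1) := by gcongr
        _ ≤ _ := by rw [mul_one]; exact le_add_self
    · have h1 : (H : ℝ≥0) ≤ m := by exact_mod_cast not_lt.1 hm
      have h2 : c / 2 * H ≤ c / 2 * m := by gcongr
      calc b + c / 2 * (m + 1) = (b + c / 2) + c / 2 * m := by ring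
        _ ≤ c / 2 * m + c / 2 * m := by gcongr; exact hH.trans h2
        _ = (c / 2 + c / 2) * m := by ring
        _ = _ := by rw [add_halves]; simp
  have hd : tabooOperator P o V + ((c / 2 : ℝ≥0) : ℝ≥0∞) • (fun x => (h x : ℝ≥0∞) + 1) ≤
      V + ((b + c / 2 * (H + 1) : ℝ≥0) : ℝ≥0∞) • {y | h y < H}.indicator 1 := by
    intro x
    have h1 : (b : ℝ≥0∞) + ((c / 2 : ℝ≥0) : ℝ≥0∞) * ((h x : ℝ≥0∞) + 1) ≤ c * h x +
        ((b + c / 2 * (H + 1) : ℝ≥0) : ℝ≥0∞) * {y | h y < H}.indicator 1 x := by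
      have h2 : (({y | h y < H}.indicator 1 x : ℝ≥0∞)) = ((if h x < H then 1 else 0 : ℝ≥0)) := by
        by_cases hx : h x < H <;> simp [hx]
      rw [h2]
      exact_mod_cast hnn (h x)
    have h3 : P V x + c * h x ≤ V x + b := hdrift x
    have h4 : tabooOperator P o V x ≤ P V x := tabooOperator_le P o V x
    simp only [Pi.add_apply, Pi.smul_apply, smul_eq_mul]
    refine (ENNReal.add_le_add_iff_left (a := (b : ℝ≥0∞)) ENNReal.coe_ne_top).1 ?_
    calc _ = tabooOperator P o V x +
          ((b : ℝ≥0∞) + ((c / 2 : ℝ≥0) : ℝ≥0∞) * ((h x : ℝ≥0∞) + 1)) := by ring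
      _ ≤ P V x + (c * h x +
          ((b + c / 2 * (H + 1) : ℝ≥0) : ℝ≥0∞) * {y | h y < H}.indicator 1 x) := by gcongr
      _ = (P V x + c * h x) +
          ((b + c / 2 * (H + 1) : ℝ≥0) : ℝ≥0∞) * {y | h y < H}.indicator 1 x := by ring
      _ ≤ (V x + b) +
          ((b + c / 2 * (H + 1) : ℝ≥0) : ℝ≥0∞) * {y | h y < H}.indicator 1 x := by gcongr
      _ = _ := by ring
  have h5 := excursionSum_le_of_drift P o hd
  rw [excursionSum_smul, excursionSum_smul] at h5
  have h6 := ne_top_of_le_ne_top (ENNReal.add_ne_top.2 ⟨hV, ENNReal.mul_ne_top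
    ENNReal.coe_ne_top (excursionSum_sublevel_ne_top hP hδ hlev H)⟩) h5
  intro h7
  rw [h7, ENNReal.mul_top (by simpa using hc)] at h6
  exact h6 rfl

/-- Convergence of the means of a function dominated by the level, for a chain started at the
atom `o`: the decomposition by the last visit to `o` is a convolution of the renewal sequence of
the visits with the summable contributions of an excursion. -/
theorem exists_tendsto_pow_apply (hP : P 1 = 1) {h : S → ℕ} (ho : h o = 0) {δ : ℝ≥0∞}
    (hδ : δ ≠ 0) (hlev : ∀ x, δ ≤ P ({y | y = o ∨ h y < h x}.indicator 1) x)
    {V : S → ℝ≥0∞} (hV : V o ≠ ⊤) {c b : ℝ≥0} (hc : c ≠ 0)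
    (hdrift : ∀ x, P V x + c * h x ≤ V x + b) {f : S → ℝ≥0∞} (hf : ∀ x, f x ≤ h x) :
    (∀ n, (P ^ n) f o ≠ ⊤) ∧
      ∃ l : ℝ, Tendsto (fun n => ((P ^ n) f o).toReal) atTop (𝓝 l) := by
  set T := tabooOperator P o with hT
  have hlevel := excursionSum_level_ne_top hP hδ hlev hV hc hdrift
  have hGf : excursionSum P o f ≠ ⊤ :=
    ne_top_of_le_ne_top hlevel (excursionSum_mono P o fun x => (hf x).trans le_self_add)
  have hG1 : excursionSum P o 1 ≠ ⊤ :=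
    ne_top_of_le_ne_top hlevel (excursionSum_mono P o fun x => le_add_self)
  have hTf : ∀ n, (T ^ n) f o ≠ ⊤ := ENNReal.ne_top_of_tsum_ne_top hGf
  have hT1 : ∀ n, (T ^ n) 1 o ≠ ⊤ := ENNReal.ne_top_of_tsum_ne_top hG1
  have hP1 : ∀ n, (P ^ n) 1 = 1 := by
    intro n
    induction n with
    | zero => simp
    | succ n ih => rw [pow_succ, Module.End.mul_apply, hP, ih]
  have hu1 : ∀ n, (P ^ n) (({o} : Set S).indicator 1) o ≤ 1 := by
    intro n
    have := linearMap_mono (P ^ n) (Set.indicator_le_self' (s := ({o} : Set S))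
      (f := (1 : S → ℝ≥0∞)) fun _ _ => zero_le_one) o
    simpa [hP1 n] using this
  have hut : ∀ n, (P ^ n) (({o} : Set S).indicator 1) o ≠ ⊤ := fun n =>
    ne_top_of_le_ne_top ENNReal.one_ne_top (hu1 n)
  have hu : ∀ n, ((P ^ n) (({o} : Set S).indicator 1) o).toReal ∈ Set.Icc (0 : ℝ) 1 := fun n =>
    ⟨ENNReal.toReal_nonneg, by simpa using ENNReal.toReal_mono ENNReal.one_ne_top (hu1 n)⟩
  have hsum : ∀ (g : S → ℝ≥0∞), (∀ n, (T ^ n) g o ≠ ⊤) → ∀ n, ((P ^ n) g o).toReal =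
      ∑ k ∈ Finset.range (n + 1), ((T ^ k) g o).toReal *
        ((P ^ (n - k)) (({o} : Set S).indicator 1) o).toReal := by
    intro g hg n
    rw [pow_apply_eq_sum_last_visit,
      ENNReal.toReal_sum fun k _ => ENNReal.mul_ne_top (hg k) (hut _)]
    simp only [ENNReal.toReal_mul, hT]
  have hT1' : T 1 ≤ 1 := by
    have := tabooOperator_le P o 1
    rwa [hP] at this
  have hr1 : ((T ^ 1) 1 o).toReal < 1 := by
    have h1 := congrFun (tabooOperator_one_add (o := o) hP) o
    have h2 : 0 < P (({o} : Set S).indicator 1) o := by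
      have := hlev o
      simp only [ho, not_lt_zero, or_false, Set.ofPred_eq_eq_singleton] at this
      exact (pos_iff_ne_zero.2 hδ).trans_le this
    rw [Pi.add_apply, Pi.one_apply] at h1
    have h3 : tabooOperator P o 1 o < 1 := by
      refine lt_of_le_of_ne (hT1' o) fun h4 => ?_
      rw [h4] at h1
      have h5 : (1 : ℝ≥0∞) < 1 + P (({o} : Set S).indicator 1) o :=
        ENNReal.lt_add_right ENNReal.one_ne_top h2.ne'
      exact h5.ne' h1
    rw [pow_one]
    have := (ENNReal.toReal_lt_toReal (hT1 1) ENNReal.one_ne_top).2 (by rw [pow_one]; exact h3)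
    simpa using this
  have hconv := tendsto_renewal (r := fun n => ((T ^ n) 1 o).toReal)
    (u := fun n => ((P ^ n) (({o} : Set S).indicator 1) o).toReal)
    (antitone_nat_of_succ_le fun n => ENNReal.toReal_mono (hT1 n) (by
      rw [pow_succ, Module.End.mul_apply]
      exact linearMap_mono (T ^ n) hT1' o))
    (by simp) hr1 (ENNReal.summable_toReal hG1) hu (fun n => by
      rw [← hsum 1 hT1 n, hP1]; simp)
  refine ⟨fun n => ?_, _, (tendsto_convolution hu hconv (ENNReal.summable_toReal hGf)
    fun n => ENNReal.toReal_nonneg).congr fun n => (hsum f hTf n).symm⟩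
  rw [pow_apply_eq_sum_last_visit]
  exact ENNReal.sum_ne_top.2 fun k _ => ENNReal.mul_ne_top (hTf k) (hut _)

end MarkovOperator

/-! ### Subspaces over a finite field -/

section FiniteField

variable {𝔽 M : Type*} [Field 𝔽] [AddCommGroup M] [Module 𝔽 M]

/-- Over a finite field with `q` elements, a finite-dimensional space is not covered by fewer than
`q` proper subspaces, as each of them contains at most `1 / q` of its vectors. -/
theorem exists_mem_forall_notMem_of_card_lt [Fintype 𝔽] (U : Submodule 𝔽 M)
    [FiniteDimensional 𝔽 U] {ι : Type*} (I : Finset ι) (W : ι → Submodule 𝔽 M)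
    (hW : ∀ i ∈ I, W i < U) (hI : I.card < Fintype.card 𝔽) :
    ∃ v ∈ U, ∀ i ∈ I, v ∉ W i := by
  by_contra! hcon
  have : Finite U := Module.finite_of_finite 𝔽
  have hUfin : (U : Set M).Finite := Set.toFinite _
  have hncard : ∀ W : Submodule 𝔽 M, W ≤ U →
      (W : Set M).ncard = Fintype.card 𝔽 ^ Module.finrank 𝔽 W := by
    intro W hWU
    have : FiniteDimensional 𝔽 W := Submodule.finiteDimensional_of_le hWU
    rw [← Nat.card_coe_set_eq, ← Nat.card_eq_fintype_card (α := 𝔽)]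
    exact Module.natCard_eq_pow_finrank (K := 𝔽) (V := W)
  have hcover : (U : Set M) ⊆ ⋃ i ∈ I, (W i : Set M) := by
    intro v hv
    obtain ⟨i, hi, hvi⟩ := hcon v hv
    exact Set.mem_biUnion hi hvi
  have h1 : (U : Set M).ncard ≤ ∑ i ∈ I, (W i : Set M).ncard := by
    refine (Set.ncard_le_ncard hcover ?_).trans (Finset.set_ncard_biUnion_le I _)
    exact I.finite_toSet.biUnion fun i hi => hUfin.subset (hW i hi).le
  have h2 : ∀ i ∈ I, Fintype.card 𝔽 * (W i : Set M).ncard ≤ (U : Set M).ncard := by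
    intro i hi
    rw [hncard _ (hW i hi).le, hncard U le_rfl, ← pow_succ']
    exact Nat.pow_le_pow_right Fintype.card_pos (Submodule.finrank_lt_finrank_of_lt (hW i hi))
  have h3 : Fintype.card 𝔽 * (U : Set M).ncard ≤ I.card * (U : Set M).ncard := by
    calc Fintype.card 𝔽 * (U : Set M).ncard
        ≤ Fintype.card 𝔽 * ∑ i ∈ I, (W i : Set M).ncard := by gcongr
      _ = ∑ i ∈ I, Fintype.card 𝔽 * (W i : Set M).ncard := Finset.mul_sum _ _ _
      _ ≤ ∑ _i ∈ I, (U : Set M).ncard := Finset.sum_le_sum h2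
      _ = _ := by simp
  have h4 : 0 < (U : Set M).ncard := (Set.ncard_pos hUfin).2 ⟨0, U.zero_mem⟩
  exact absurd (Nat.le_of_mul_le_mul_right h3 h4) (not_le.2 hI)

theorem finrank_sup_span_singleton_of_notMem {W : Submodule 𝔽 M} [FiniteDimensional 𝔽 W] {v : M}
    (hv : v ∉ W) :
    Module.finrank 𝔽 (W ⊔ Submodule.span 𝔽 {v} : Submodule 𝔽 M) = Module.finrank 𝔽 W + 1 := by
  have hdisj : W ⊓ Submodule.span 𝔽 {v} = ⊥ :=
    (Submodule.disjoint_span_singleton_of_notMem hv).eq_bot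
  have h := Submodule.finrank_sup_add_finrank_inf_eq W (Submodule.span 𝔽 {v})
  rwa [hdisj, finrank_bot, add_zero,
    finrank_span_singleton fun h0 : v = 0 => hv (h0 ▸ W.zero_mem)] at h

end FiniteField

namespace MulticastSwitch

/-! ### Knowledge spaces and the queue recursion -/

section Dynamics

variable {K N : ℕ} {P : TrafficPattern K N} {𝔽 : Type*} [Field 𝔽]

theorem inputKnowledge_eq_span_range (α : ℕ → P.Flow → ℕ) (t : ℕ) (f : P.Flow) :
    inputKnowledge 𝔽 α t f = Submodule.span 𝔽 (Set.range
      fun k : Fin (∑ τ ∈ Finset.range t, α τ f) => Finsupp.single (k : ℕ) (1 : 𝔽)) := by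
  unfold inputKnowledge
  congr 1
  ext v
  constructor
  · rintro ⟨k, hk, rfl⟩
    exact ⟨⟨k, hk⟩, rfl⟩
  · rintro ⟨k, rfl⟩
    exact ⟨k, k.2, rfl⟩

instance (α : ℕ → P.Flow → ℕ) (t : ℕ) (f : P.Flow) :
    FiniteDimensional 𝔽 (inputKnowledge 𝔽 α t f) := by
  rw [inputKnowledge_eq_span_range]
  exact FiniteDimensional.span_of_finite 𝔽 (Set.finite_range _)

theorem finrank_inputKnowledge (α : ℕ → P.Flow → ℕ) (t : ℕ) (f : P.Flow) :
    Module.finrank 𝔽 (inputKnowledge 𝔽 α t f) = ∑ τ ∈ Finset.range t, α τ f := by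
  rw [inputKnowledge_eq_span_range, finrank_span_eq_card, Fintype.card_fin]
  have h : LinearIndependent 𝔽 fun k : ℕ => Finsupp.single k (1 : 𝔽) := by
    simpa using (Finsupp.basisSingleOne (R := 𝔽) (ι := ℕ)).linearIndependent
  exact h.comp _ Fin.val_injective

theorem inputKnowledge_le_succ (α : ℕ → P.Flow → ℕ) (t : ℕ) (f : P.Flow) :
    inputKnowledge 𝔽 α t f ≤ inputKnowledge 𝔽 α (t + 1) f := by
  refine Submodule.span_mono ?_
  rintro v ⟨k, hk, rfl⟩
  exact ⟨k, hk.trans_le (by rw [Finset.sum_range_succ]; exact Nat.le_add_right _ _), rfl⟩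

variable {σ : (P.Subflow → ℕ) → Finset P.Subflow} {α : ℕ → P.Flow → ℕ}
  {c : ℕ → P.Flow → (ℕ →₀ 𝔽)}

theorem outputKnowledge_succ (t : ℕ) (s : P.Subflow) :
    outputKnowledge σ α c (t + 1) s = if s ∈ served σ (virtualQueue σ α c t)
      then outputKnowledge σ α c t s ⊔ Submodule.span 𝔽 {c t s.flow}
      else outputKnowledge σ α c t s := rfl

theorem outputKnowledge_le_inputKnowledge {t : ℕ}
    (hc : ∀ τ < t, ∀ f, IsInnovativeChoice σ α c τ f (c τ f)) (s : P.Subflow) :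
    outputKnowledge σ α c t s ≤ inputKnowledge 𝔽 α t s.flow := by
  induction t with
  | zero => exact bot_le
  | succ t ih =>
    have h := (ih fun τ hτ => hc τ (hτ.trans t.lt_succ_self)).trans
      (inputKnowledge_le_succ α t s.flow)
    rw [outputKnowledge_succ]
    split_ifs
    · refine sup_le h ((Submodule.span_singleton_le_iff_mem _ _).2 ?_)
      exact inputKnowledge_le_succ α t s.flow (hc t t.lt_succ_self s.flow).1
    · exact h

theorem exists_isInnovativeChoice [Fintype 𝔽]
    (hcard : ∀ f : P.Flow, f.1.2.card < Fintype.card 𝔽) {t : ℕ}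
    (hc : ∀ τ < t, ∀ f, IsInnovativeChoice σ α c τ f (c τ f)) (f : P.Flow) :
    ∃ v, IsInnovativeChoice σ α c t f v := by
  set I := (served σ (virtualQueue σ α c t)).filter fun s => s.flow = f
  have hlt : ∀ s ∈ I, outputKnowledge σ α c t s < inputKnowledge 𝔽 α t f := by
    intro s hs
    obtain ⟨hserved, rfl⟩ := Finset.mem_filter.1 hs
    refine lt_of_le_of_ne (outputKnowledge_le_inputKnowledge hc s) fun heq => ?_
    have hpos : 0 < virtualQueue σ α c t s := (Finset.mem_filter.1 hserved).2
    rw [virtualQueue, virtualQueueSize, heq, Nat.sub_self] at hpos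
    exact hpos.false
  -- a subflow of `f` is determined by its output, an element of the fanout set
  have hcardI : I.card ≤ f.1.2.card := by
    refine Finset.card_le_card_of_injOn (fun s => s.output) ?_ ?_
    · intro s hs
      obtain ⟨-, rfl⟩ := Finset.mem_filter.1 hs
      exact s.2
    · intro s hs s' hs' h
      have h1 := (Finset.mem_filter.1 hs).2
      have h2 := (Finset.mem_filter.1 hs').2
      exact Subtype.ext (Prod.ext (h1.trans h2.symm) h)
  obtain ⟨v, hvU, hv⟩ := exists_mem_forall_notMem_of_card_lt _ I _ hlt (hcardI.trans_lt (hcard f))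
  exact ⟨v, hvU, fun s hs hsf => hv s (Finset.mem_filter.2 ⟨hs, hsf⟩)⟩

/-- The queue sizes after a slot that starts with queue sizes `q` and sees the arrivals `A`: every
served queue loses one unit, and every queue gains the arrivals of its flow. -/
def nextQueue (σ : (P.Subflow → ℕ) → Finset P.Subflow) (q : P.Subflow → ℕ) (A : P.Flow → ℕ) :
    P.Subflow → ℕ :=
  fun s => q s - (if s ∈ served σ q then 1 else 0) + A s.flow

theorem virtualQueue_zero : virtualQueue σ α c 0 = 0 := by
  funext s
  simp [virtualQueue, virtualQueueSize, finrank_inputKnowledge]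

/-- Whichever innovative combinations are used, the queue sizes follow the same recursion. -/
theorem virtualQueue_succ {t : ℕ}
    (hc : ∀ τ ≤ t, ∀ f, IsInnovativeChoice σ α c τ f (c τ f)) :
    virtualQueue σ α c (t + 1) = nextQueue σ (virtualQueue σ α c t) (α t) := by
  funext s
  have hle := outputKnowledge_le_inputKnowledge (fun τ hτ => hc τ hτ.le) s
  have hfin : FiniteDimensional 𝔽 (outputKnowledge σ α c t s) :=
    Submodule.finiteDimensional_of_le hle
  have hrank := Submodule.finrank_mono hle
  have hq : virtualQueue σ α c t s = Module.finrank 𝔽 (inputKnowledge 𝔽 α t s.flow) -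
    Module.finrank 𝔽 (outputKnowledge σ α c t s) := rfl
  have hU : Module.finrank 𝔽 (inputKnowledge 𝔽 α (t + 1) s.flow) =
      Module.finrank 𝔽 (inputKnowledge 𝔽 α t s.flow) + α t s.flow := by
    simp only [finrank_inputKnowledge, Finset.sum_range_succ]
  rw [nextQueue]
  by_cases hs : s ∈ served σ (virtualQueue σ α c t)
  · have hpos : 0 < virtualQueue σ α c t s := (Finset.mem_filter.1 hs).2
    have hW := finrank_sup_span_singleton_of_notMem ((hc t le_rfl s.flow).2 s hs rfl)
    rw [if_pos hs, virtualQueue, virtualQueueSize, outputKnowledge_succ, if_pos hs, hW, hU]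
    omega
  · rw [if_neg hs, virtualQueue, virtualQueueSize, outputKnowledge_succ, if_neg hs, hU]
    omega

end Dynamics

end MulticastSwitch

/-! ### Chains driven by independent identically distributed variables -/

section RandomRecursion

variable {S E : Type*} [MeasurableSpace E] [DiscreteMeasurableSpace E]

/-- The transition operator of the Markov chain `X (t + 1) = F (X t) (ξ t)`, where the `ξ t` are
independent with law `ν`, acting on nonnegative functions. -/
noncomputable def transitionOperator (F : S → E → S) (ν : Measure E) :
    Module.End ℝ≥0∞ (S → ℝ≥0∞) where
  toFun f x := ∫⁻ A, f (F x A) ∂ν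
  map_add' f g := by
    funext x
    exact lintegral_add_left (Measurable.of_discrete (f := fun A => f (F x A))) _
  map_smul' a f := by
    funext x
    exact lintegral_const_mul a (Measurable.of_discrete (f := fun A => f (F x A)))

theorem transitionOperator_apply (F : S → E → S) (ν : Measure E) (f : S → ℝ≥0∞) (x : S) :
    transitionOperator F ν f x = ∫⁻ A, f (F x A) ∂ν := rfl

theorem transitionOperator_one (F : S → E → S) (ν : Measure E) [IsProbabilityMeasure ν] :
    transitionOperator F ν 1 = 1 := by
  funext x
  simp [transitionOperator_apply]

/-- The mean of `f (X t)` is given by the `t`-th power of the transition operator. -/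
theorem lintegral_eq_transitionOperator_pow [Countable E] [Countable S] [MeasurableSpace S]
    [DiscreteMeasurableSpace S] {Ω : Type*} [MeasurableSpace Ω] {μ : Measure Ω}
    [IsProbabilityMeasure μ] {F : S → E → S} {ν : Measure E} {o : S} {X : ℕ → Ω → S}
    {ξ : ℕ → Ω → E} (hX : ∀ t, Measurable (X t)) (hξ : ∀ t, Measurable (ξ t))
    (hX0 : ∀ ω, X 0 ω = o) (hXs : ∀ t ω, X (t + 1) ω = F (X t ω) (ξ t ω))
    (hind : ∀ t, IndepFun (X t) (ξ t) μ) (hlaw : ∀ t, μ.map (ξ t) = ν) (t : ℕ)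
    (f : S → ℝ≥0∞) :
    ∫⁻ ω, f (X t ω) ∂μ = (transitionOperator F ν ^ t) f o := by
  induction t generalizing f with
  | zero => simp [hX0]
  | succ t ih =>
    rw [pow_succ, Module.End.mul_apply, ← ih]
    have hνp : IsProbabilityMeasure ν := by
      rw [← hlaw 0]
      exact Measure.isProbabilityMeasure_map (hξ 0).aemeasurable
    have hprod := (hind t).map_prod_eq_prod_map_map (hX t).aemeasurable (hξ t).aemeasurable
    have hm : Measurable fun p : S × E => f (F p.1 p.2) := Measurable.of_discrete
    have hXp : IsProbabilityMeasure (μ.map (X t)) :=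
      Measure.isProbabilityMeasure_map (hX t).aemeasurable
    calc ∫⁻ ω, f (X (t + 1) ω) ∂μ = ∫⁻ ω, f (F (X t ω) (ξ t ω)) ∂μ := by simp only [hXs]
      _ = ∫⁻ p, f (F p.1 p.2) ∂(μ.map fun ω => (X t ω, ξ t ω)) :=
        (lintegral_map hm ((hX t).prodMk (hξ t))).symm
      _ = ∫⁻ x, ∫⁻ A, f (F x A) ∂ν ∂(μ.map (X t)) := by
        rw [hprod, hlaw t, lintegral_prod _ hm.aemeasurable]
      _ = ∫⁻ ω, transitionOperator F ν f (X t ω) ∂μ :=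
        lintegral_map (Measurable.of_discrete (f := transitionOperator F ν f)) (hX t)

end RandomRecursion

namespace MulticastSwitch

variable {K N : ℕ} {P : TrafficPattern K N}

/-! ### The stable set polytope and the rate region -/

section RateRegion

/-- A linear functional with nonnegative integer coefficients is maximized over the stable set
polytope at a maximum weight stable set. -/
theorem sum_mul_le_of_mem_stableSetPolytope {V : Type*} [Fintype V] {G : SimpleGraph V}
    {x : V → ℝ} (hx : x ∈ stableSetPolytope G) {w : V → ℕ} {S : Finset V}
    (hS : IsMaxWeightStableSet G w S) : ∑ v, (w v : ℝ) * x v ≤ ∑ v ∈ S, (w v : ℝ) := by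
  classical
  let φ : (V → ℝ) →ₗ[ℝ] ℝ := ∑ v, (w v : ℝ) • LinearMap.proj v
  have hφ : ∀ y, φ y = ∑ v, (w v : ℝ) * y v := fun y => by simp [φ]
  have hconv : Convex ℝ {y | φ y ≤ ∑ v ∈ S, (w v : ℝ)} := convex_halfSpace_le φ.isLinear _
  have hsub : {y : V → ℝ | ∃ T : Set V, G.IsIndepSet T ∧ y = T.indicator 1} ⊆
      {y | φ y ≤ ∑ v ∈ S, (w v : ℝ)} := by
    rintro y ⟨T, hT, rfl⟩
    have h1 := hS.2 T.toFinset (by simpa using hT)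
    have h2 : φ (T.indicator 1) = ((∑ v ∈ T.toFinset, w v : ℕ) : ℝ) := by
      rw [hφ, Nat.cast_sum, ← Finset.sum_subset (Finset.subset_univ T.toFinset)]
      · refine Finset.sum_congr rfl fun v hv => ?_
        rw [Set.indicator_of_mem (Set.mem_toFinset.1 hv)]
        simp
      · intro v _ hv
        rw [Set.indicator_of_notMem fun h => hv (Set.mem_toFinset.2 h), mul_zero]
    change φ (T.indicator 1) ≤ _
    rw [h2]
    exact_mod_cast h1
  have := convexHull_min hsub hconv hx
  rwa [← hφ]

theorem apply_le_one_of_mem_stableSetPolytope {V : Type*} {G : SimpleGraph V} {x : V → ℝ}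
    (hx : x ∈ stableSetPolytope G) (v : V) : x v ≤ 1 := by
  have hconv : Convex ℝ {y : V → ℝ | LinearMap.proj (R := ℝ) (φ := fun _ => ℝ) v y ≤ 1} :=
    convex_halfSpace_le (LinearMap.isLinear _) _
  refine convexHull_min ?_ hconv hx
  rintro y ⟨T, -, rfl⟩
  by_cases h : v ∈ T <;> simp [h]

/-- An interior rate vector can be increased by the same positive amount in all coordinates. -/
theorem exists_add_mem_rateRegion {r : P.Flow → ℝ≥0} (hr : r ∈ interior (rateRegion P)) :
    ∃ ε : ℝ≥0, ε ≠ 0 ∧ (fun f => r f + ε) ∈ rateRegion P := by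
  have hcont : Tendsto (fun ε : ℝ≥0 => fun f : P.Flow => r f + ε) (𝓝 0) (𝓝 r) := by
    have h : Continuous fun ε : ℝ≥0 => fun f : P.Flow => r f + ε := by fun_prop
    simpa using h.tendsto 0
  have h1 := (hcont.mono_left (nhdsWithin_le_nhds (s := Set.Ioi 0))).eventually
    (mem_interior_iff_mem_nhds.1 hr)
  obtain ⟨ε, hε, hε0⟩ := (h1.and self_mem_nhdsWithin).exists
  exact ⟨ε, ne_of_gt (show (0 : ℝ≥0) < ε from hε0), hε⟩

end RateRegion

/-! ### The Markov chain of the queue sizes -/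

section QueueChain

/-- The total size of all queues. -/
def totalQueue (q : P.Subflow → ℕ) : ℕ := ∑ s, q s

variable {σ : (P.Subflow → ℕ) → Finset P.Subflow}

/-- Without arrivals the queues drain: a maximum weight stable set contains a nonempty queue. -/
theorem nextQueue_zero_drains
    (hσ : ∀ q, IsMaxWeightStableSet P.enhancedConflictGraph q (σ q)) (q : P.Subflow → ℕ) :
    nextQueue σ q 0 = 0 ∨ totalQueue (nextQueue σ q 0) < totalQueue q := by
  by_cases hq : ∀ s, q s = 0
  · left
    funext s
    simp [nextQueue, hq s]
  · right
    push Not at hq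
    obtain ⟨s, hs⟩ := hq
    have h1 := (hσ q).2 {s} (by simp)
    rw [Finset.sum_singleton] at h1
    obtain ⟨u, hu, hu0⟩ : ∃ u ∈ σ q, q u ≠ 0 := by
      by_contra! hcon
      rw [Finset.sum_eq_zero hcon] at h1
      omega
    have hserved : u ∈ served σ q := Finset.mem_filter.2 ⟨hu, Nat.pos_of_ne_zero hu0⟩
    refine Finset.sum_lt_sum (fun v _ => ?_) ⟨u, Finset.mem_univ u, ?_⟩
    · simp [nextQueue]
    · simp only [nextQueue, hserved, if_true, Pi.zero_apply]
      omega

/-- The change of a squared queue size. An empty queue of the stable set is not served, but then the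
second summand on the left vanishes as well. -/
theorem nextQueue_sq_add_le (q : P.Subflow → ℕ) (A : P.Flow → ℕ) (s : P.Subflow) :
    nextQueue σ q A s ^ 2 + 2 * (if s ∈ σ q then q s else 0) ≤
      q s ^ 2 + 2 * (q s * A s.flow) + (A s.flow ^ 2 + 1) := by
  by_cases hs : s ∈ σ q
  · rcases Nat.eq_zero_or_pos (q s) with h0 | hpos
    · simp [nextQueue, h0]
    · have hserved : s ∈ served σ q := Finset.mem_filter.2 ⟨hs, hpos⟩
      obtain ⟨n, hn⟩ := Nat.exists_eq_add_of_lt hpos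
      simp only [nextQueue, hserved, hs, if_true, hn]
      rw [show 0 + n + 1 - 1 = n by omega]
      nlinarith
  · have hserved : s ∉ served σ q := fun h => hs (Finset.mem_filter.1 h).1
    simp only [nextQueue, hserved, hs, if_false]
    rw [Nat.sub_zero]
    nlinarith

/-- The drift of the sum of the squared queue sizes is at most a constant minus a multiple of the
total queue size, because a maximum weight stable set beats the rate vector `r + ε`, which is a
convex combination of stable sets. -/
theorem drift_sum_sq (hσ : ∀ q, IsMaxWeightStableSet P.enhancedConflictGraph q (σ q))
    {ν : Measure (P.Flow → ℕ)} [IsProbabilityMeasure ν] {r : P.Flow → ℝ≥0} {ε : ℝ≥0}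
    (hε : (fun f => r f + ε) ∈ rateRegion P)
    (hmean : ∀ f, ∫⁻ A, (A f : ℝ≥0∞) ∂ν = r f)
    (q : P.Subflow → ℕ) :
    transitionOperator (nextQueue σ) ν (fun x => ∑ s, (x s : ℝ≥0∞) ^ 2) q +
        ((2 * ε : ℝ≥0) : ℝ≥0∞) * totalQueue q ≤
      ∑ s, (q s : ℝ≥0∞) ^ 2 + ∑ s : P.Subflow, (∫⁻ A, (A s.flow : ℝ≥0∞) ^ 2 ∂ν + 1) := by
  set B : ℝ≥0∞ := ∑ s : P.Subflow, (∫⁻ A, (A s.flow : ℝ≥0∞) ^ 2 ∂ν + 1) with hB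
  have hmeas : ∀ g : (P.Flow → ℕ) → ℝ≥0∞, Measurable g := fun g => Measurable.of_discrete
  set R : ℝ≥0∞ := ∑ s : P.Subflow, 2 * ((q s : ℝ≥0∞) * r s.flow) with hR
  have hRtop : R ≠ ⊤ := ENNReal.sum_ne_top.2 fun s _ => ENNReal.mul_ne_top (by simp)
    (ENNReal.mul_ne_top (by simp) ENNReal.coe_ne_top)
  have h1 : transitionOperator (nextQueue σ) ν (fun x => ∑ s, (x s : ℝ≥0∞) ^ 2) q +
      2 * ∑ s ∈ σ q, (q s : ℝ≥0∞) ≤ ∑ s, (q s : ℝ≥0∞) ^ 2 + R + B := by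
    have hpt : ∀ A : P.Flow → ℕ, ∑ s, (nextQueue σ q A s : ℝ≥0∞) ^ 2 +
        2 * ∑ s ∈ σ q, (q s : ℝ≥0∞) ≤ ∑ s, (q s : ℝ≥0∞) ^ 2 +
          ∑ s, 2 * ((q s : ℝ≥0∞) * A s.flow) + ∑ s : P.Subflow, ((A s.flow : ℝ≥0∞) ^ 2 + 1) := by
      intro A
      have h := Finset.sum_le_sum fun s (_ : s ∈ Finset.univ) => nextQueue_sq_add_le (σ := σ) q A s
      simp only [Finset.sum_add_distrib (s := (Finset.univ : Finset P.Subflow)),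
        ← Finset.mul_sum (Finset.univ : Finset P.Subflow), Finset.sum_ite_mem,
        Finset.univ_inter] at h ⊢
      exact_mod_cast h
    calc transitionOperator (nextQueue σ) ν (fun x => ∑ s, (x s : ℝ≥0∞) ^ 2) q +
          2 * ∑ s ∈ σ q, (q s : ℝ≥0∞)
        = ∫⁻ A, (∑ s, (nextQueue σ q A s : ℝ≥0∞) ^ 2 + 2 * ∑ s ∈ σ q, (q s : ℝ≥0∞)) ∂ν := by
          rw [lintegral_add_left (hmeas _), lintegral_const, measure_univ, mul_one]
          rfl
      _ ≤ ∫⁻ A, (∑ s, (q s : ℝ≥0∞) ^ 2 + ∑ s, 2 * ((q s : ℝ≥0∞) * A s.flow) +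
            ∑ s : P.Subflow, ((A s.flow : ℝ≥0∞) ^ 2 + 1)) ∂ν := lintegral_mono hpt
      _ = ∑ s, (q s : ℝ≥0∞) ^ 2 + R + B := by
          rw [lintegral_add_left (hmeas _), lintegral_add_left (hmeas _), lintegral_const,
            measure_univ, mul_one, lintegral_finsetSum _ fun s _ => hmeas _,
            lintegral_finsetSum _ fun s _ => hmeas _]
          congr 2
          · congr 1
            funext s
            rw [lintegral_const_mul _ (hmeas _), lintegral_const_mul _ (hmeas _), hmean]
          · funext s
            rw [lintegral_add_left (hmeas _), lintegral_const, measure_univ, mul_one]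
  have h2 : ((2 * ε : ℝ≥0) : ℝ≥0∞) * totalQueue q + R ≤ 2 * ∑ s ∈ σ q, (q s : ℝ≥0∞) := by
    have h := sum_mul_le_of_mem_stableSetPolytope hε (hσ q)
    have h' : ∑ s : P.Subflow, (q s : ℝ≥0) * (r s.flow + ε) ≤ ∑ s ∈ σ q, (q s : ℝ≥0) := by
      rw [← NNReal.coe_le_coe]
      simpa [enhancedRate] using h
    have h3 : (2 * ε) * (totalQueue q : ℝ≥0) + ∑ s : P.Subflow, 2 * ((q s : ℝ≥0) * r s.flow) ≤
        2 * ∑ s ∈ σ q, (q s : ℝ≥0) := by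
      refine le_trans (le_of_eq ?_) (mul_le_mul_right h' 2)
      simp only [totalQueue, Nat.cast_sum, Finset.mul_sum, ← Finset.sum_add_distrib]
      exact Finset.sum_congr rfl fun s _ => by ring
    rw [hR]
    exact_mod_cast h3
  refine (ENNReal.add_le_add_iff_right hRtop).1 ?_
  calc _ = transitionOperator (nextQueue σ) ν (fun x => ∑ s, (x s : ℝ≥0∞) ^ 2) q +
        (((2 * ε : ℝ≥0) : ℝ≥0∞) * totalQueue q + R) := by rw [add_assoc]
    _ ≤ transitionOperator (nextQueue σ) ν (fun x => ∑ s, (x s : ℝ≥0∞) ^ 2) q +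
        2 * ∑ s ∈ σ q, (q s : ℝ≥0∞) := by gcongr
    _ ≤ _ := h1
    _ = _ := by ring

/-- The queue sizes at the start of slot `t` as a function of the arrivals. -/
def queueOfArrivals (σ : (P.Subflow → ℕ) → Finset P.Subflow) (α : ℕ → P.Flow → ℕ) :
    ℕ → P.Subflow → ℕ
  | 0 => 0
  | t + 1 => nextQueue σ (queueOfArrivals σ α t) (α t)

theorem virtualQueue_eq_queueOfArrivals {𝔽 : Type*} [Field 𝔽] {α : ℕ → P.Flow → ℕ}
    {c : ℕ → P.Flow → (ℕ →₀ 𝔽)} (hc : ∀ t f, IsInnovativeChoice σ α c t f (c t f)) (t : ℕ) :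
    virtualQueue σ α c t = queueOfArrivals σ α t := by
  induction t with
  | zero => exact virtualQueue_zero
  | succ t ih => rw [virtualQueue_succ fun τ _ => hc τ, ih, queueOfArrivals]

theorem queueOfArrivals_congr {α β : ℕ → P.Flow → ℕ} {t : ℕ} (h : ∀ τ < t, α τ = β τ) :
    queueOfArrivals σ α t = queueOfArrivals σ β t := by
  induction t with
  | zero => rfl
  | succ t ih =>
    rw [queueOfArrivals, queueOfArrivals, ih fun τ hτ => h τ (hτ.trans t.lt_succ_self),
      h t t.lt_succ_self]

variable {Ω : Type*} [MeasurableSpace Ω] {μ : Measure Ω} {a : ℕ → P.Flow → Ω → ℕ}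

/-- `queueOfArrivals` at time `t` factors through the finitely many arrival numbers of the slots
before `t`. -/
theorem exists_queueOfArrivals_eq (σ : (P.Subflow → ℕ) → Finset P.Subflow) (t : ℕ) :
    ∃ φ : ((Finset.range t ×ˢ (Finset.univ : Finset P.Flow) : Finset (ℕ × P.Flow)) → ℕ) →
      (P.Subflow → ℕ), ∀ α : ℕ → P.Flow → ℕ,
        queueOfArrivals σ α t = φ fun p => α p.1.1 p.1.2 := by
  refine ⟨fun y => queueOfArrivals σ (fun τ f => if h : (τ, f) ∈
    Finset.range t ×ˢ (Finset.univ : Finset P.Flow) then y ⟨(τ, f), h⟩ else 0) t,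
    fun α => queueOfArrivals_congr fun τ hτ => ?_⟩
  funext f
  simp [hτ]

theorem measurable_queueOfArrivals (ha : ∀ t f, Measurable (a t f)) (t : ℕ) :
    Measurable fun ω => queueOfArrivals σ (fun τ f => a τ f ω) t := by
  obtain ⟨φ, hφ⟩ := exists_queueOfArrivals_eq σ t
  simp only [hφ]
  exact (Measurable.of_discrete (f := φ)).comp (measurable_pi_lambda _ fun p => ha _ _)

theorem indepFun_queueOfArrivals (ha : ∀ t f, Measurable (a t f))
    (hindep : iIndepFun (fun p : ℕ × P.Flow => a p.1 p.2) μ) (t : ℕ) :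
    IndepFun (fun ω => queueOfArrivals σ (fun τ f => a τ f ω) t) (fun ω f => a t f ω) μ := by
  obtain ⟨φ, hφ⟩ := exists_queueOfArrivals_eq σ t
  have hdisj : Disjoint (Finset.range t ×ˢ (Finset.univ : Finset P.Flow))
      ({t} ×ˢ (Finset.univ : Finset P.Flow)) := by
    rw [Finset.disjoint_left]
    rintro ⟨τ, f⟩ h1 h2
    simp only [Finset.mem_product, Finset.mem_range, Finset.mem_singleton, Finset.mem_univ,
      and_true] at h1 h2
    omega
  have h := hindep.indepFun_finset _ _ hdisj fun p => ha p.1 p.2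
  let ψ : (({t} ×ˢ (Finset.univ : Finset P.Flow) : Finset (ℕ × P.Flow)) → ℕ) → P.Flow → ℕ :=
    fun y f => y ⟨(t, f), by simp⟩
  have h2 := h.comp (φ := φ) (ψ := ψ) Measurable.of_discrete Measurable.of_discrete
  simp only [hφ]
  exact h2

variable [IsProbabilityMeasure μ]

theorem map_arrivals_eq_pi (ha : ∀ t f, Measurable (a t f))
    (hindep : iIndepFun (fun p : ℕ × P.Flow => a p.1 p.2) μ)
    (hident : ∀ t f, IdentDistrib (a t f) (a 0 f) μ μ) (t : ℕ) :
    μ.map (fun ω f => a t f ω) = Measure.pi fun f => μ.map (a 0 f) := by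
  have h : iIndepFun (fun f : P.Flow => a t f) μ :=
    hindep.precomp (g := fun f : P.Flow => (t, f)) fun f f' h => (Prod.ext_iff.1 h).2
  rw [(iIndepFun_iff_map_fun_eq_pi_map fun f => (ha t f).aemeasurable).1 h]
  congr 1
  funext f
  exact (hident t f).map_eq

/-- A random natural number with mean below `1` vanishes with positive probability. -/
theorem measure_preimage_zero_ne_zero {X : Ω → ℕ}
    (hint : Integrable (fun ω => (X ω : ℝ)) μ) (hlt : ∫ ω, (X ω : ℝ) ∂μ < 1) :
    μ (X ⁻¹' {0}) ≠ 0 := by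
  intro h0
  have h1 : ∀ᵐ ω ∂μ, (1 : ℝ) ≤ X ω := by
    have h2 : ∀ᵐ ω ∂μ, ω ∉ X ⁻¹' {0} := measure_eq_zero_iff_ae_notMem.1 h0
    filter_upwards [h2] with ω hω
    have : 1 ≤ X ω := Nat.one_le_iff_ne_zero.2 hω
    exact_mod_cast this
  have h3 := integral_mono_ae (integrable_const (1 : ℝ)) hint h1
  simp at h3
  linarith

end QueueChain

end MulticastSwitch

open MulticastSwitch in
theorem mainTheorem8 {K N : ℕ} (P : MulticastSwitch.TrafficPattern K N)
    -- a finite field with more elements than any flow has outputs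
    {𝔽 : Type*} [Field 𝔽] [Fintype 𝔽] (hcard : ∀ f : P.Flow, f.1.2.card < Fintype.card 𝔽)
    -- a rule that computes a maximum weight stable set from the virtual queue sizes
    (σ : (P.Subflow → ℕ) → Finset P.Subflow)
    (hσ : ∀ q, MulticastSwitch.IsMaxWeightStableSet P.enhancedConflictGraph q (σ q))
    -- the arrivals: `a t f` packets of flow `f` arrive in slot `t`
    {Ω : Type*} [MeasurableSpace Ω] (μ : Measure Ω) [IsProbabilityMeasure μ]
    (a : ℕ → P.Flow → Ω → ℕ) (ha : ∀ t f, Measurable (a t f))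
    (hindep : iIndepFun (fun p : ℕ × P.Flow => a p.1 p.2) μ)
    (hident : ∀ t f, IdentDistrib (a t f) (a 0 f) μ μ)
    (hsq : ∀ f, MemLp (fun ω => (a 0 f ω : ℝ)) 2 μ)
    -- the rate vector lies inside the rate region
    (r : P.Flow → ℝ≥0) (hr : ∀ f, ∫ ω, (a 0 f ω : ℝ) ∂μ = r f)
    (hint : r ∈ interior (MulticastSwitch.rateRegion P)) :
    -- on every sample path an innovative linear combination exists in every slot
    (∀ (α : ℕ → P.Flow → ℕ) (c : ℕ → P.Flow → (ℕ →₀ 𝔽)) (t : ℕ),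
      (∀ τ < t, ∀ f, MulticastSwitch.IsInnovativeChoice σ α c τ f (c τ f)) →
        ∀ f, ∃ v, MulticastSwitch.IsInnovativeChoice σ α c t f v) ∧
    -- whichever innovative linear combinations are used, the virtual queues are stable in the mean
    (∀ c : Ω → ℕ → P.Flow → (ℕ →₀ 𝔽),
      (∀ ω t f, MulticastSwitch.IsInnovativeChoice σ (fun τ g => a τ g ω) (c ω) t f (c ω t f)) →
        MulticastSwitch.StableInMean μ
          (fun t s ω => MulticastSwitch.virtualQueue σ (fun τ g => a τ g ω) (c ω) t s)) := by
  refine ⟨fun α c t hc f => exists_isInnovativeChoice hcard hc f, fun c hc s => ?_⟩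
  simp only [virtualQueue_eq_queueOfArrivals (hc _)]
  obtain ⟨ε, hε0, hε⟩ := exists_add_mem_rateRegion hint
  have hinteg : ∀ f, Integrable (fun ω => (a 0 f ω : ℝ)) μ := fun f =>
    (hsq f).integrable one_le_two
  set ν : Measure (P.Flow → ℕ) := μ.map (fun ω f => a 0 f ω) with hν
  have hmeas : ∀ t, Measurable fun ω f => a t f ω := fun t => measurable_pi_lambda _ (ha t)
  have hνprob : IsProbabilityMeasure ν := Measure.isProbabilityMeasure_map (hmeas 0).aemeasurable
  have hlaw : ∀ t, μ.map (fun ω f => a t f ω) = ν := fun t =>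
    (map_arrivals_eq_pi ha hindep hident t).trans (map_arrivals_eq_pi ha hindep hident 0).symm
  have hmean : ∀ f, ∫⁻ A, (A f : ℝ≥0∞) ∂ν = r f := by
    intro f
    rw [hν, lintegral_map (Measurable.of_discrete (f := fun A : P.Flow → ℕ => (A f : ℝ≥0∞)))
      (hmeas 0)]
    have h := ofReal_integral_eq_lintegral_ofReal (hinteg f)
      (Filter.Eventually.of_forall fun ω => Nat.cast_nonneg _)
    simpa [hr] using h.symm
  have hsecond : ∀ f, ∫⁻ A, (A f : ℝ≥0∞) ^ 2 ∂ν ≠ ⊤ := by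
    intro f
    rw [hν, lintegral_map (Measurable.of_discrete (f := fun A : P.Flow → ℕ => (A f : ℝ≥0∞) ^ 2))
      (hmeas 0)]
    have h := ((memLp_two_iff_integrable_sq (hsq f).1).1 (hsq f)).lintegral_lt_top
    refine ne_top_of_le_ne_top h.ne (lintegral_mono fun ω => ?_)
    rw [ENNReal.ofReal_pow (Nat.cast_nonneg _), ENNReal.ofReal_natCast]
  -- a flow has rate below `1`, as no entry of a vector in the stable set polytope exceeds `1`
  have hδ : ν {0} ≠ 0 := by
    rw [hν, map_arrivals_eq_pi ha hindep hident 0, Measure.pi_singleton]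
    refine Finset.prod_ne_zero_iff.2 fun f _ => ?_
    rw [Measure.map_apply (ha 0 f) (measurableSet_singleton _)]
    refine measure_preimage_zero_ne_zero (hinteg f) ?_
    obtain ⟨j, hj⟩ := P.fanout_nonempty f.1 f.2
    have h1 := apply_le_one_of_mem_stableSetPolytope hε ⟨(f, j), hj⟩
    have h2 : ((r f + ε : ℝ≥0) : ℝ) ≤ 1 := h1
    have h3 : (0 : ℝ) < ε := by exact_mod_cast pos_iff_ne_zero.2 hε0
    rw [hr]
    push_cast at h2
    linarith
  have hlev : ∀ q : P.Subflow → ℕ, ν {0} ≤ transitionOperator (nextQueue σ) ν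
      ({y | y = 0 ∨ totalQueue y < totalQueue q}.indicator 1) q := by
    intro q
    rw [transitionOperator_apply, ← lintegral_indicator_one (measurableSet_singleton _)]
    refine lintegral_mono fun A => ?_
    by_cases hA : A = 0
    · subst hA
      rw [Set.indicator_of_mem (show nextQueue σ q 0 ∈ _ from nextQueue_zero_drains hσ q)]
      simp
    · simp [hA]
  have hB : ∑ s : P.Subflow, (∫⁻ A, (A s.flow : ℝ≥0∞) ^ 2 ∂ν + 1) ≠ ⊤ :=
    ENNReal.sum_ne_top.2 fun s _ => ENNReal.add_ne_top.2 ⟨hsecond _, ENNReal.one_ne_top⟩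
  lift ∑ s : P.Subflow, (∫⁻ A, (A s.flow : ℝ≥0∞) ^ 2 ∂ν + 1) to ℝ≥0 using hB with B hBeq
  obtain ⟨hfin, l, hl⟩ := exists_tendsto_pow_apply (transitionOperator_one (nextQueue σ) ν)
    (o := 0) (h := totalQueue) (by simp [totalQueue]) hδ hlev
    (V := fun x => ∑ s, (x s : ℝ≥0∞) ^ 2) (by simp) (c := 2 * ε) (b := B)
    (mul_ne_zero two_ne_zero hε0)
    (fun q => by rw [hBeq]; exact drift_sum_sq hσ hε hmean q)
    (f := fun q => (q s : ℝ≥0∞)) (fun q => by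
      exact_mod_cast Finset.single_le_sum (f := q) (fun _ _ => Nat.zero_le _) (Finset.mem_univ s))
  have hexp : ∀ t, ∫⁻ ω, (queueOfArrivals σ (fun τ g => a τ g ω) t s : ℝ≥0∞) ∂μ =
      (transitionOperator (nextQueue σ) ν ^ t) (fun q => (q s : ℝ≥0∞)) 0 := fun t =>
    lintegral_eq_transitionOperator_pow (measurable_queueOfArrivals ha) hmeas (fun _ => rfl)
      (fun _ _ => rfl) (indepFun_queueOfArrivals ha hindep) hlaw t fun q => (q s : ℝ≥0∞)
  have hae : ∀ t, AEMeasurable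
      (fun ω => (queueOfArrivals σ (fun τ g => a τ g ω) t s : ℝ≥0∞)) μ := fun t =>
    ((Measurable.of_discrete (f := fun q : P.Subflow → ℕ => (q s : ℝ≥0∞))).comp
      (measurable_queueOfArrivals ha t)).aemeasurable
  refine ⟨fun t => ?_, l, hl.congr fun t => ?_⟩
  · have := integrable_toReal_of_lintegral_ne_top (hae t) (by rw [hexp]; exact hfin t)
    simpa using this
  · rw [← hexp, ← integral_toReal (hae t) (Filter.Eventually.of_forall fun ω => by simp)]
    simp
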